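/- Let $1<\alpha\le 2$, $\varphi(x)=|x|^\alpha/\alpha$, $\beta=\alpha/(\alpha-1)$. A random variable $\zeta$ on a probability space $(\Omega,\mathcal F,P)$ is $\varphi$-sub-Gaussian if $E\zeta=0$, $E e^{\lambda\zeta}$ exists for every $\lambda\in\mathbb R$, and for some $a>0$ one has $E e^{\lambda\zeta}\le e^{\varphi(\lambda a)}$ for all $\lambda\in\mathbb R$; put $\tau_\varphi(\zeta)=\inf\{a>0: E e^{\lambda\zeta}\le e^{\varphi(a\lambda)}\ \text{for all } \lambda\in\mathbb R\}$. A field is $\varphi$-sub-Gaussian if all its values are. Let $A\ge 0$, $V=[0,\infty)\times[-A,A]$, $H_1,H_2\in(0,1]$ and $d(t,s)=|t_1-s_1|^{H_1}+|t_2-s_2|^{H_2}$. Let $f:[0,\infty)\to(0,\infty)$ be continuous and strictly increasing with $f(t)\to\infty$ as $t\to\infty$. Let $0=b_0<b_1<b_2<\cdots$, $b_k\to\infty$, and put $f_k=f(b_k)$, $l_k=b_{k+1}-b_k$, $V_k=[b_k,b_{k+1}]\times[-A,A]$ for $k\ge 0$. Let $X(t)$, $t=(t_1,t_2)\in V$,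 be a separable $\varphi$-sub-Gaussian random field; separable means that there is a countable dense $D\subseteq V$ such that for almost every $\omega$ and all open $U$ and closed $F\subseteq\mathbb R$, if $X(t)\in F$ for all $t\in D\cap U$ then $X(t)\in F$ for all $t\in V\cap U$. Suppose that $\varepsilon_k=\sup_{t\in V_k}\tau_\varphi(X(t))>0$ for all $k$, and that (i) there are $\gamma\in(0,1]$ with $\gamma\beta>1$ and $c_k>0$ such that for all $k\ge 0$ and $h>0$ $$\sup_{t,s\in V_k,\ d(t,s)\le h}\tau_\varphi(X(t)-X(s))\le c_k h^\gamma;$$ (ii) there are $\delta>0$ and $c(\delta)>0$ such that $\tau_\varphi(X(t_1,t_2))\le c(\delta)\,t_1^\delta$ for all $(t_1,t_2)\in V$; (iii) $\widetilde C=c(\delta)\sum_{k=0}^\infty \dfrac{b_{k+1}^\delta}{f_k}<\infty$; (iv) $\widetilde S=c(\delta)^{1-\frac1{\gamma\beta}}\sum_{k=0}^\infty \dfrac{b_{k+1}^{\delta(1-\frac1{\gamma\beta})}\,c_1(k)}{f_k}<\infty$, where $$c_1(k)=\Big(\frac1{H_1}\Big(\frac{l_k}{2}\Big)^{H_1/\beta}+\frac1{H_2}A^{H_2/\beta}\Big)\frac{2^{1/\beta}c_k^{1/(\gamma\beta)}}{1-\frac1{\gamma\beta}}.$$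 Put $\gamma_k=c_k\max_{t,s\in V_k}d(t,s)^\gamma$ and $\widetilde\theta=\inf_k \gamma_k/\varepsilon_k$. Then $\sup_{(t_1,t_2)\in V}|X(t_1,t_2)|/f(t_1)$ (with values in $[0,\infty]$) is measurable up to a null set, and for every $\theta\in(0,\min(1,\widetilde\theta))$: (a) for every $\lambda>0$ $$E\exp\Big\{\lambda\sup_{(t_1,t_2)\in V}\frac{|X(t_1,t_2)|}{f(t_1)}\Big\}\le 2\exp\Big\{\frac{\lambda^\alpha}{\alpha}\Big(\frac{\widetilde C}{1-\theta}\Big)^\alpha+\frac{2\lambda}{(1-\theta)\,\theta^{\frac1{\gamma\beta}}}\widetilde S\Big\};$$ (b) for every $u>\dfrac{2\widetilde S}{(1-\theta)\,\theta^{\frac1{\gamma\beta}}}$ $$P\Big\{\sup_{(t_1,t_2)\in V}\frac{|X(t_1,t_2)|}{f(t_1)}>u\Big\}\le 2\exp\Big\{-\frac{1}{\beta\widetilde C^\beta}\Big(u(1-\theta)-2\widetilde S\,\theta^{-\frac1{\gamma\beta}}\Big)^\beta\Big\}.$$ -/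

import Mathlib

open MeasureTheory ProbabilityTheory Filter Topology

noncomputable section

/-- The Orlicz function `φ(x) = |x| ^ α / α`. -/
def powerOrlicz (α x : ℝ) : ℝ := |x| ^ α / α

/-- `ζ` is a `φ`-sub-Gaussian random variable: it is centered, all its exponential moments exist,
and `E exp(l ζ) ≤ exp(φ(l a))` for all real `l`, with some constant `a > 0`. -/
structure IsPhiSubGaussian {Ω : Type*} [MeasurableSpace Ω] (P : Measure Ω)
    (φ : ℝ → ℝ) (ζ : Ω → ℝ) : Prop where
  integrable : Integrable ζ P
  centered : ∫ ω, ζ ω ∂P = 0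
  integrable_exp : ∀ l : ℝ, Integrable (fun ω => Real.exp (l * ζ ω)) P
  exists_bound : ∃ a : ℝ, 0 < a ∧
    ∀ l : ℝ, ∫ ω, Real.exp (l * ζ ω) ∂P ≤ Real.exp (φ (l * a))

/-- The norm `τ_φ(ζ) = inf {a > 0 : E exp(l ζ) ≤ exp(φ(a l)) for all l}`. -/
def phiNorm {Ω : Type*} [MeasurableSpace Ω] (P : Measure Ω) (φ : ℝ → ℝ) (ζ : Ω → ℝ) : ℝ :=
  sInf {a : ℝ | 0 < a ∧ ∀ l : ℝ, ∫ ω, Real.exp (l * ζ ω) ∂P ≤ Real.exp (φ (a * l))}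

/-- Separability of the field `X` on the parameter set `V`: there is a countable dense `D ⊆ V`
such that, outside one null set of `ω`, for every (relatively) open `U` and every closed `F`, if
`X t ω ∈ F` for all `t ∈ D ∩ U` then `X t ω ∈ F` for all `t ∈ V ∩ U`. (The anisotropic metric
below induces the usual topology of the plane.) -/
def IsSeparableField {Ω : Type*} [MeasurableSpace Ω] (P : Measure Ω)
    (V : Set (ℝ × ℝ)) (X : ℝ × ℝ → Ω → ℝ) : Prop :=
  ∃ D : Set (ℝ × ℝ), D.Countable ∧ D ⊆ V ∧ V ⊆ closure D ∧
    ∀ᵐ ω ∂P, ∀ U : Set (ℝ × ℝ), IsOpen U → ∀ F : Set ℝ, IsClosed F →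
      (∀ t ∈ D ∩ U, X t ω ∈ F) → ∀ t ∈ V ∩ U, X t ω ∈ F

/-- The anisotropic metric `|t₁ - s₁| ^ H₁ + |t₂ - s₂| ^ H₂`. -/
def anisoDist (H₁ H₂ : ℝ) (t s : ℝ × ℝ) : ℝ :=
  |t.1 - s.1| ^ H₁ + |t.2 - s.2| ^ H₂

/-- The unbounded domain `V = [0, ∞) × [-A, A]`. -/
def halfStrip (A : ℝ) : Set (ℝ × ℝ) := Set.Ici 0 ×ˢ Set.Icc (-A) A

/-- The block `V_k = [b_k, b_{k+1}] × [-A, A]`. -/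
def stripBlock (b : ℕ → ℝ) (A : ℝ) (k : ℕ) : Set (ℝ × ℝ) :=
  Set.Icc (b k) (b (k + 1)) ×ˢ Set.Icc (-A) A

/-- `ε_k`, the supremum of `τ_φ(X(t))` over `t ∈ V_k`. -/
def blockEps {Ω : Type*} [MeasurableSpace Ω] (P : Measure Ω) (φ : ℝ → ℝ)
    (X : ℝ × ℝ → Ω → ℝ) (b : ℕ → ℝ) (A : ℝ) (k : ℕ) : ℝ :=
  sSup ((fun t => phiNorm P φ (X t)) '' stripBlock b A k)

/-- `γ_k = c_k max d(t, s) ^ γ`, the maximum over `t, s ∈ V_k`. -/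
def blockGamma (H₁ H₂ γ : ℝ) (ck b : ℕ → ℝ) (A : ℝ) (k : ℕ) : ℝ :=
  ck k * sSup ((fun p : (ℝ × ℝ) × (ℝ × ℝ) => anisoDist H₁ H₂ p.1 p.2 ^ γ) ''
    (stripBlock b A k ×ˢ stripBlock b A k))

/-- The infimum over `k` of `γ_k / ε_k`. -/
def thetaTilde {Ω : Type*} [MeasurableSpace Ω] (P : Measure Ω) (φ : ℝ → ℝ)
    (X : ℝ × ℝ → Ω → ℝ) (H₁ H₂ γ : ℝ) (ck b : ℕ → ℝ) (A : ℝ) : ℝ :=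
  ⨅ k : ℕ, blockGamma H₁ H₂ γ ck b A k / blockEps P φ X b A k

/-- The constant `c₁(k)`, in which `l_k = b_{k+1} - b_k`. -/
def blockConst (H₁ H₂ γ β : ℝ) (ck b : ℕ → ℝ) (A : ℝ) (k : ℕ) : ℝ :=
  (1 / H₁ * ((b (k + 1) - b k) / 2) ^ (H₁ / β) + 1 / H₂ * A ^ (H₂ / β)) *
    (2 ^ (1 / β) * ck k ^ (1 / (γ * β)) / (1 - 1 / (γ * β)))

/-- The supremum of `|X(t₁, t₂)| / f(t₁)` over `V`, as an extended real number. -/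
def weightedSup {Ω : Type*} (V : Set (ℝ × ℝ)) (X : ℝ × ℝ → Ω → ℝ) (f : ℝ → ℝ) (ω : Ω) : EReal :=
  ⨆ t ∈ V, ((|X t ω| / f t.1 : ℝ) : EReal)

end

/-- `M` is measurable up to a null set and `E exp(l M) ≤ 2 exp((l T) ^ α / α + l e)` for `l > 0`. -/
structure HasExpBound {Ω : Type*} [MeasurableSpace Ω] (P : Measure Ω)
    (α : ℝ) (M : Ω → ℝ) (T e : ℝ) : Prop where
  aemeasurable : AEMeasurable M P
  bound : ∀ l : ℝ, 0 < l → ∫⁻ ω, ENNReal.ofReal (Real.exp (l * M ω)) ∂P ≤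
    ENNReal.ofReal (2 * Real.exp ((l * T) ^ α / α + l * e))

/-- `Y` is measurable up to a null set and `E exp(l Y) ≤ exp(|l τ| ^ α / α)` for all `l`. -/
structure HasPowerMgfBound {Ω : Type*} [MeasurableSpace Ω] (P : Measure Ω)
    (α : ℝ) (Y : Ω → ℝ) (τ : ℝ) : Prop where
  aemeasurable : AEMeasurable Y P
  bound : ∀ l : ℝ, ∫⁻ ω, ENNReal.ofReal (Real.exp (l * Y ω)) ∂P ≤
    ENNReal.ofReal (Real.exp (|l * τ| ^ α / α))

/-- The maximum of `|Y t|` over a finite set. -/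
noncomputable def finsetAbsSup {Ω ι : Type*} (F : Finset ι) (Y : ι → Ω → ℝ) (ω : Ω) : ℝ :=
  ((F.sup fun t => ‖Y t ω‖₊ : NNReal) : ℝ)

lemma finsetAbsSup_nonneg {Ω ι : Type*} (F : Finset ι) (Y : ι → Ω → ℝ) (ω : Ω) :
    0 ≤ finsetAbsSup F Y ω := NNReal.coe_nonneg _

lemma abs_le_finsetAbsSup {Ω ι : Type*} {F : Finset ι} (Y : ι → Ω → ℝ) (ω : Ω) {t : ι} (ht : t ∈ F) :
    |Y t ω| ≤ finsetAbsSup F Y ω := by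
  have : ‖Y t ω‖₊ ≤ F.sup fun t => ‖Y t ω‖₊ := Finset.le_sup (f := fun t => ‖Y t ω‖₊) ht
  exact_mod_cast this

lemma finsetAbsSup_le {Ω ι : Type*} {F : Finset ι} {Y : ι → Ω → ℝ} {ω : Ω} {a : ℝ} (ha : 0 ≤ a)
    (h : ∀ t ∈ F, |Y t ω| ≤ a) : finsetAbsSup F Y ω ≤ a := by
  lift a to NNReal using ha
  refine NNReal.coe_le_coe.2 (Finset.sup_le fun t ht => ?_)
  exact_mod_cast h t ht

lemma exists_abs_eq_finsetAbsSup {Ω ι : Type*} {F : Finset ι} (hF : F.Nonempty) (Y : ι → Ω → ℝ)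
    (ω : Ω) : ∃ t ∈ F, |Y t ω| = finsetAbsSup F Y ω := by
  obtain ⟨t, ht, h⟩ := Finset.exists_mem_eq_sup F hF fun t => ‖Y t ω‖₊
  exact ⟨t, ht, by simp [finsetAbsSup, h]⟩

section

variable {Ω : Type*} [MeasurableSpace Ω] {P : Measure Ω} {α : ℝ}

lemma lintegral_exp_convex {Z₁ Z₂ : Ω → ℝ} (h₁ : AEMeasurable Z₁ P) 
    {w₁ w₂ : ℝ} (hw₁ : 0 ≤ w₁) (hw₂ : 0 ≤ w₂) (hw : w₁ + w₂ = 1) {B : ENNReal}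
    (hB₁ : ∫⁻ ω, ENNReal.ofReal (Real.exp (Z₁ ω)) ∂P ≤ B)
    (hB₂ : ∫⁻ ω, ENNReal.ofReal (Real.exp (Z₂ ω)) ∂P ≤ B) :
    ∫⁻ ω, ENNReal.ofReal (Real.exp (w₁ * Z₁ ω + w₂ * Z₂ ω)) ∂P ≤ B := by
  calc ∫⁻ ω, ENNReal.ofReal (Real.exp (w₁ * Z₁ ω + w₂ * Z₂ ω)) ∂P
      ≤ ∫⁻ ω, (ENNReal.ofReal w₁ * ENNReal.ofReal (Real.exp (Z₁ ω)) +
          ENNReal.ofReal w₂ * ENNReal.ofReal (Real.exp (Z₂ ω))) ∂P := by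
        refine lintegral_mono fun ω => ?_
        rw [← ENNReal.ofReal_mul hw₁, ← ENNReal.ofReal_mul hw₂,
          ← ENNReal.ofReal_add (by positivity) (by positivity)]
        exact ENNReal.ofReal_le_ofReal
          (by simpa using convexOn_exp.2 (Set.mem_univ (Z₁ ω)) (Set.mem_univ (Z₂ ω)) hw₁ hw₂ hw)
    _ = ENNReal.ofReal w₁ * ∫⁻ ω, ENNReal.ofReal (Real.exp (Z₁ ω)) ∂P +
          ENNReal.ofReal w₂ * ∫⁻ ω, ENNReal.ofReal (Real.exp (Z₂ ω)) ∂P := by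
        rw [lintegral_add_left' (by fun_prop), lintegral_const_mul' _ _ ENNReal.ofReal_ne_top,
          lintegral_const_mul' _ _ ENNReal.ofReal_ne_top]
    _ ≤ ENNReal.ofReal w₁ * B + ENNReal.ofReal w₂ * B := by gcongr
    _ = B := by rw [← add_mul, ← ENNReal.ofReal_add hw₁ hw₂, hw]; simp

lemma lintegral_exp_sub_const (Z : Ω → ℝ) (q : ℝ) :
    ∫⁻ ω, ENNReal.ofReal (Real.exp (Z ω - q)) ∂P =
      ENNReal.ofReal (Real.exp (-q)) * ∫⁻ ω, ENNReal.ofReal (Real.exp (Z ω)) ∂P := by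
  rw [← lintegral_const_mul' _ _ ENNReal.ofReal_ne_top]
  refine lintegral_congr fun ω => ?_
  rw [← ENNReal.ofReal_mul (Real.exp_pos _).le, ← Real.exp_add]
  ring_nf

lemma lintegral_exp_sub_const_le_iff {Z : Ω → ℝ} {q B : ℝ} :
    ∫⁻ ω, ENNReal.ofReal (Real.exp (Z ω - q)) ∂P ≤ ENNReal.ofReal B ↔
      ∫⁻ ω, ENNReal.ofReal (Real.exp (Z ω)) ∂P ≤ ENNReal.ofReal (B * Real.exp q) := by
  rw [lintegral_exp_sub_const, mul_comm B, ENNReal.ofReal_mul (Real.exp_pos _).le, Real.exp_neg,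
    ENNReal.ofReal_inv_of_pos (Real.exp_pos _),
    ENNReal.inv_mul_le_iff (by simp [Real.exp_pos]) ENNReal.ofReal_ne_top]

namespace HasExpBound

lemma mono {M M' : Ω → ℝ} {T T' e e' : ℝ} (h : HasExpBound P α M T e) (hα : 0 < α)
    (hM' : AEMeasurable M' P) (hM : ∀ ω, M' ω ≤ M ω) (hT₀ : 0 ≤ T) (hT : T ≤ T') (he : e ≤ e') :
    HasExpBound P α M' T' e' := by
  refine ⟨hM', fun l hl => ?_⟩
  refine le_trans (lintegral_mono fun ω => ?_) ((h.bound l hl).trans ?_)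
  · have := hM ω
    gcongr
  · gcongr

lemma const_mul {M : Ω → ℝ} {T e : ℝ} (h : HasExpBound P α M T e) {a : ℝ} (ha : 0 < a) :
    HasExpBound P α (fun ω => a * M ω) (a * T) (a * e) := by
  refine ⟨h.aemeasurable.const_mul a, fun l hl => ?_⟩
  simpa only [mul_assoc] using h.bound (l * a) (by positivity)

lemma add {M₁ M₂ : Ω → ℝ} {T₁ T₂ e₁ e₂ : ℝ} (h₁ : HasExpBound P α M₁ T₁ e₁)
    (h₂ : HasExpBound P α M₂ T₂ e₂) (hT₁ : 0 < T₁) (hT₂ : 0 < T₂) :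
    HasExpBound P α (fun ω => M₁ ω + M₂ ω) (T₁ + T₂) (e₁ + e₂) := by
  have m₁ := h₁.aemeasurable
  have m₂ := h₂.aemeasurable
  refine ⟨m₁.add m₂, fun l hl => ?_⟩
  have key : ∀ {M : Ω → ℝ} {T e : ℝ}, HasExpBound P α M T e → 0 < T →
      ∫⁻ ω, ENNReal.ofReal (Real.exp (l * ((T₁ + T₂) / T) * M ω - l * ((T₁ + T₂) / T) * e)) ∂P ≤
        ENNReal.ofReal (2 * Real.exp ((l * (T₁ + T₂)) ^ α / α)) := by
    intro M T e h hT
    rw [lintegral_exp_sub_const_le_iff, mul_assoc, ← Real.exp_add]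
    convert h.bound (l * ((T₁ + T₂) / T)) (by positivity) using 6
    field_simp
  have := lintegral_exp_convex (by fun_prop) (w₁ := T₁ / (T₁ + T₂))
    (w₂ := T₂ / (T₁ + T₂)) (by positivity) (by positivity) (by field_simp) (key h₁ hT₁) (key h₂ hT₂)
  rw [Real.exp_add, ← mul_assoc, ← lintegral_exp_sub_const_le_iff]
  convert this using 5
  field_simp
  ring

lemma of_forall_pos_add {M : Ω → ℝ} {T e : ℝ}
    (h : ∀ η : ℝ, 0 < η → HasExpBound P α M T (e + η)) : HasExpBound P α M T e := by
  refine ⟨(h 1 one_pos).aemeasurable, fun l hl => ?_⟩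
  have : Tendsto (fun η : ℝ => ENNReal.ofReal (2 * Real.exp ((l * T) ^ α / α + l * (e + η))))
      (𝓝[>] 0) (𝓝 (ENNReal.ofReal (2 * Real.exp ((l * T) ^ α / α + l * (e + 0))))) :=
    (ENNReal.continuous_ofReal.comp (by fun_prop)).continuousWithinAt
  rw [add_zero] at this
  exact ge_of_tendsto this (by filter_upwards [self_mem_nhdsWithin] with η hη using (h η hη).bound l hl)

end HasExpBound

lemma aemeasurable_finsetAbsSup {ι : Type*} {F : Finset ι} {Y : ι → Ω → ℝ}
    (h : ∀ t ∈ F, AEMeasurable (Y t) P) : AEMeasurable (finsetAbsSup F Y) P := by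
  classical
  have : AEMeasurable (fun ω => F.sup fun t => ‖Y t ω‖₊) P := by
    induction F using Finset.induction_on with
    | empty => simp
    | insert t F _ ih =>
      simp only [Finset.sup_insert]
      exact (h t (by simp)).nnnorm.sup (ih fun s hs => h s (by simp [hs]))
  exact this.coe_nnreal_real

variable [IsProbabilityMeasure P]

lemma lintegral_exp_finsetAbsSup_le {ι : Type*} {F : Finset ι} {Y : ι → Ω → ℝ} {τ N l : ℝ}
    (hα : 0 < α) (hτ : 0 < τ) (hl : 0 < l) (hY : ∀ t ∈ F, HasPowerMgfBound P α (Y t) τ)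
    (hN : (F.card : ℝ) ≤ N) (hN₁ : 1 ≤ N) :
    ∫⁻ ω, ENNReal.ofReal (Real.exp (l * finsetAbsSup F Y ω)) ∂P ≤
      ENNReal.ofReal (2 * N * Real.exp ((l * τ) ^ α / α)) := by
  rcases F.eq_empty_or_nonempty with rfl | hF
  · simp only [finsetAbsSup, Finset.sup_empty, bot_eq_zero, NNReal.coe_zero, mul_zero, Real.exp_zero,
      ENNReal.ofReal_one, lintegral_one, measure_univ]
    rw [← ENNReal.ofReal_one]
    have : 1 ≤ Real.exp ((l * τ) ^ α / α) := Real.one_le_exp (by positivity)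
    exact ENNReal.ofReal_le_ofReal (by nlinarith)
  calc ∫⁻ ω, ENNReal.ofReal (Real.exp (l * finsetAbsSup F Y ω)) ∂P
      ≤ ∫⁻ ω, ∑ t ∈ F, (ENNReal.ofReal (Real.exp (l * Y t ω)) +
          ENNReal.ofReal (Real.exp (-l * Y t ω))) ∂P := by
        refine lintegral_mono fun ω => ?_
        obtain ⟨t, ht, h⟩ := exists_abs_eq_finsetAbsSup hF Y ω
        refine le_trans ?_ (Finset.single_le_sum (f := fun t => ENNReal.ofReal (Real.exp (l * Y t ω)) +
          ENNReal.ofReal (Real.exp (-l * Y t ω))) (fun _ _ => zero_le) ht)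
        rw [← h]
        rcases abs_choice (Y t ω) with h' | h' <;> rw [h']
        · exact le_self_add
        · rw [mul_neg, ← neg_mul]; exact le_add_self
    _ = ∑ t ∈ F, (∫⁻ ω, ENNReal.ofReal (Real.exp (l * Y t ω)) ∂P +
          ∫⁻ ω, ENNReal.ofReal (Real.exp (-l * Y t ω)) ∂P) := by
        have hm : ∀ t ∈ F, ∀ r : ℝ, AEMeasurable (fun ω => ENNReal.ofReal (Real.exp (r * Y t ω))) P :=
          fun t ht r => by have := (hY t ht).aemeasurable; fun_prop
        rw [lintegral_finsetSum' F fun t ht => by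
          have := (hY t ht).aemeasurable; fun_prop]
        exact Finset.sum_congr rfl fun t ht => lintegral_add_left' (hm t ht _) _
    _ ≤ ∑ _t ∈ F, ENNReal.ofReal (2 * Real.exp ((l * τ) ^ α / α)) := by
        refine Finset.sum_le_sum fun t ht => ?_
        have h₁ := (hY t ht).bound l
        have h₂ := (hY t ht).bound (-l)
        rw [neg_mul, abs_neg] at h₂
        rw [abs_of_pos (by positivity)] at h₁ h₂
        rw [two_mul, ENNReal.ofReal_add (by positivity) (by positivity)]
        exact add_le_add h₁ h₂
    _ ≤ _ := by
        rw [Finset.sum_const, nsmul_eq_mul, ← ENNReal.ofReal_natCast,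
          ← ENNReal.ofReal_mul (by positivity)]
        refine ENNReal.ofReal_le_ofReal ?_
        have := Real.exp_pos ((l * τ) ^ α / α)
        nlinarith

lemma hasExpBound_finsetAbsSup {ι : Type*} {F : Finset ι} {Y : ι → Ω → ℝ} {β τ L : ℝ}
    (hα : 1 < α) (hβ : 1 / β = 1 - 1 / α) (hτ : 0 < τ) (hY : ∀ t ∈ F, HasPowerMgfBound P α (Y t) τ)
    (hL : 0 ≤ L) (hF : (F.card : ℝ) ≤ Real.exp L) :
    HasExpBound P α (finsetAbsSup F Y) τ (2 * (τ * L ^ (1 / β))) := by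
  have hm := aemeasurable_finsetAbsSup fun t ht => (hY t ht).aemeasurable
  refine ⟨hm, fun l hl => ?_⟩
  have hα₀ : 0 < α := by linarith
  have hβ₀ : 0 < 1 / β := by rw [hβ, sub_pos, div_lt_one hα₀]; exact hα
  have hmain : ∀ r : ℝ, 0 < r → ∫⁻ ω, ENNReal.ofReal (Real.exp (r * finsetAbsSup F Y ω)) ∂P ≤
      ENNReal.ofReal (2 * Real.exp L * Real.exp ((r * τ) ^ α / α)) := fun r hr =>
    lintegral_exp_finsetAbsSup_le hα₀ hτ hr hY hF (Real.one_le_exp hL)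
  rcases le_or_gt (L ^ (1 / α)) (l * τ) with h | h
  · refine (hmain l hl).trans (ENNReal.ofReal_le_ofReal ?_)
    rw [mul_assoc, ← Real.exp_add]
    refine mul_le_mul_of_nonneg_left (Real.exp_le_exp.2 ?_) zero_le_two
    have hL' : L ≤ l * τ * L ^ (1 / β) := by
      calc L = L ^ (1 / α) * L ^ (1 / β) := by
            rw [← Real.rpow_add_of_nonneg hL (by positivity) hβ₀.le, hβ]; simp
        _ ≤ _ := by gcongr
    have : 0 ≤ l * τ * L ^ (1 / β) := by positivity
    linarith
  · have hL₀ : 0 < L := by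
      refine lt_of_le_of_ne hL fun h' => ?_
      rw [← h', Real.zero_rpow (by positivity)] at h
      exact absurd h (not_lt.2 (by positivity))
    set x := L ^ (1 / α) with hx
    have hx₀ : 0 < x := by positivity
    have hxα : x ^ α = L := by rw [hx, ← Real.rpow_mul hL]; field_simp; simp
    set Q := Real.log 2 + L + L / α with hQ
    have h1 := hmain (x / τ) (by positivity)
    have h2 : ∫⁻ ω, ENNReal.ofReal (Real.exp (x / τ * finsetAbsSup F Y ω - Q)) ∂P ≤
        ENNReal.ofReal 1 := by
      rw [lintegral_exp_sub_const_le_iff]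
      convert h1 using 2
      rw [div_mul_cancel₀ _ hτ.ne', hxα, one_mul, hQ, Real.exp_add, Real.exp_add,
        Real.exp_log two_pos]
    have hs : l * τ / x ≤ 1 := by rw [div_le_one hx₀]; exact h.le
    have h3 := lintegral_exp_convex (P := P) (Z₂ := fun _ => 0) (by fun_prop)
      (w₁ := l * τ / x) (w₂ := 1 - l * τ / x) (by positivity) (by linarith) (by ring) h2 (by simp)
    have h4 : ∫⁻ ω, ENNReal.ofReal (Real.exp (l * finsetAbsSup F Y ω - l * τ / x * Q)) ∂P ≤
        ENNReal.ofReal 1 := by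
      convert h3 using 5
      field_simp
      ring
    rw [lintegral_exp_sub_const_le_iff, one_mul] at h4
    refine h4.trans (ENNReal.ofReal_le_ofReal ?_)
    rw [← Real.exp_log (show (0 : ℝ) < 2 * Real.exp _ by positivity),
      Real.log_mul two_ne_zero (Real.exp_ne_zero _), Real.log_exp]
    gcongr
    have h5 : L = x * L ^ (1 / β) := by
      rw [hx, ← Real.rpow_add hL₀, hβ]; simp
    have h6 : l * τ / x * L = l * τ * L ^ (1 / β) := by
      rw [div_mul_eq_mul_div, div_eq_iff hx₀.ne', mul_assoc _ _ x, mul_comm _ x, ← h5]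
    have h7 : L / α ≤ L := div_le_self hL hα.le
    have h8 : 0 ≤ (l * τ) ^ α / α := by positivity
    have h9 : 0 ≤ l * τ / x := by positivity
    have h10 : 0 < Real.log 2 := Real.log_pos one_lt_two
    rw [hQ]
    nlinarith

end

section

variable {Ω : Type*} [MeasurableSpace Ω] {P : Measure Ω} [IsProbabilityMeasure P] {α β : ℝ}

lemma HasExpBound.finsetAbsSup_of_net {ι : Type*} {F G : Finset ι} {X : ι → Ω → ℝ} {T e τ L : ℝ}
    (hα : 1 < α) (hβ : 1 / β = 1 - 1 / α) (hT : 0 < T) (hτ : 0 < τ) (hL : 0 ≤ L)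
    (hF : (F.card : ℝ) ≤ Real.exp L) (hX : ∀ t ∈ F, AEMeasurable (X t) P)
    (hG : HasExpBound P α (finsetAbsSup G X) T e)
    (hFG : ∀ t ∈ F, ∃ s ∈ G, HasPowerMgfBound P α (fun ω => X t ω - X s ω) τ) :
    HasExpBound P α (finsetAbsSup F X) (T + τ) (e + 2 * (τ * L ^ (1 / β))) := by
  choose! π hπG hπ using hFG
  have h := hG.add (hasExpBound_finsetAbsSup (Y := fun t ω => X t ω - X (π t) ω) hα hβ hτ hπ hL hF)
    hT hτ
  refine h.mono (by linarith) (aemeasurable_finsetAbsSup hX) (fun ω => ?_) (by positivity) le_rfl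
    le_rfl
  refine finsetAbsSup_le (add_nonneg (finsetAbsSup_nonneg _ _ _) (finsetAbsSup_nonneg _ _ _))
    fun t ht => ?_
  calc |X t ω| = |X (π t) ω + (X t ω - X (π t) ω)| := by ring_nf
    _ ≤ |X (π t) ω| + |X t ω - X (π t) ω| := abs_add_le _ _
    _ ≤ _ := add_le_add (abs_le_finsetAbsSup X ω (hπG t ht))
        (abs_le_finsetAbsSup (fun t ω => X t ω - X (π t) ω) ω ht)

/-- Chaining along nets with increments bounded by `ε θ ^ (n + 1)`. -/
lemma hasExpBound_finsetAbsSup_of_nets {ι : Type*} {K : Set ι} {X : ι → Ω → ℝ} {ε θ Λ : ℝ}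
    (hα : 1 < α) (hβ : 1 / β = 1 - 1 / α) (hε : 0 < ε) (hθ : 0 < θ) (hθ₁ : θ < 1)
    (hX : ∀ t ∈ K, HasPowerMgfBound P α (X t) ε) {S : ℕ → Finset ι} (hS : ∀ n, ↑(S n) ⊆ K)
    (hnet : ∀ n, ∀ t ∈ K, ∃ s ∈ S n,
      HasPowerMgfBound P α (fun ω => X t ω - X s ω) (ε * θ ^ (n + 1)))
    {L : ℕ → ℝ} (hL : ∀ n, 0 ≤ L n) (hcard : ∀ n, ((S n).card : ℝ) ≤ Real.exp (L n))
    (hΛ : ∀ n, ∑ i ∈ Finset.range n, ε * θ ^ i * L i ^ (1 / β) ≤ Λ)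
    {F : Finset ι} (hF : ↑F ⊆ K) :
    HasExpBound P α (finsetAbsSup F X) (ε / (1 - θ)) (2 * Λ) := by
  have hT : ∀ n, 0 < ∑ i ∈ Finset.range (n + 1), ε * θ ^ i := fun n =>
    Finset.sum_pos (fun i _ => by positivity) (by simp)
  have hT' : ∀ n, ∑ i ∈ Finset.range n, ε * θ ^ i ≤ ε / (1 - θ) := fun n => by
    rw [div_eq_mul_inv, ← tsum_geometric_of_lt_one hθ.le hθ₁, ← tsum_mul_left]
    exact ((summable_geometric_of_lt_one hθ.le hθ₁).mul_left ε).sum_le_tsum _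
      fun i _ => by positivity
  have hlev : ∀ n, HasExpBound P α (finsetAbsSup (S n) X) (∑ i ∈ Finset.range (n + 1), ε * θ ^ i)
      (2 * ∑ i ∈ Finset.range (n + 1), ε * θ ^ i * L i ^ (1 / β)) := by
    intro n
    induction n with
    | zero =>
      simpa using hasExpBound_finsetAbsSup hα hβ hε (fun t ht => hX t (hS 0 ht)) (hL 0) (hcard 0)
    | succ n ih =>
      rw [Finset.sum_range_succ, Finset.sum_range_succ _ (n + 1), mul_add]
      exact HasExpBound.finsetAbsSup_of_net hα hβ (hT n) (by positivity) (hL _) (hcard _)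
        (fun t ht => (hX t (hS _ ht)).aemeasurable) ih fun t ht => hnet n t (hS _ ht)
  refine HasExpBound.of_forall_pos_add fun η hη => ?_
  obtain ⟨R, hR, hFR⟩ : ∃ R : ℝ, 0 ≤ R ∧ (F.card : ℝ) ≤ Real.exp R :=
    ⟨F.card, by positivity, by linarith [Real.add_one_le_exp (F.card : ℝ)]⟩
  have hlim : Tendsto (fun n : ℕ => 2 * (ε * θ ^ (n + 1) * R ^ (1 / β))) atTop
      (𝓝 (2 * (ε * 0 * R ^ (1 / β)))) :=
    ((((tendsto_pow_atTop_nhds_zero_of_lt_one hθ.le hθ₁).comp (tendsto_add_atTop_nat 1)).const_mul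
      ε).mul_const _).const_mul 2
  rw [mul_zero, zero_mul, mul_zero] at hlim
  obtain ⟨n, hn⟩ := (hlim.eventually_lt_const hη).exists
  refine (HasExpBound.finsetAbsSup_of_net hα hβ (hT n) (by positivity) hR hFR
    (fun t ht => (hX t (hF ht)).aemeasurable) (hlev n) (fun t ht => hnet n t (hF ht))).mono
      (by linarith) (aemeasurable_finsetAbsSup fun t ht => (hX t (hF ht)).aemeasurable)
      (fun _ => le_rfl) (add_nonneg (hT n).le (by positivity)) ?_ ?_
  · rw [← Finset.sum_range_succ]
    exact hT' _
  · linarith [hΛ (n + 1)]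

end

lemma sum_geometric_entropy_le {ε θ a κ : ℝ} (hε : 0 < ε) (hθ : 0 < θ) (hθ₁ : θ < 1) (ha : 0 < a)
    (ha₁ : a < 1) (hκ : 0 ≤ κ) (n : ℕ) :
    ∑ i ∈ Finset.range n, ε * θ ^ i * (κ * (ε * θ ^ (i + 1)) ^ (-a)) ≤
      ε ^ (1 - a) * (κ / (1 - a)) / ((1 - θ) * θ ^ a) := by
  have hq₀ : 0 < θ ^ (1 - a) := by positivity
  have hq₁ : θ ^ (1 - a) < 1 := Real.rpow_lt_one hθ.le hθ₁ (by linarith)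
  have hq : (1 - a) * (1 - θ) ≤ 1 - θ ^ (1 - a) := by
    have := rpow_one_add_le_one_add_mul_self (s := θ - 1) (p := 1 - a) (by linarith)
      (by linarith) (by linarith)
    rw [add_sub_cancel] at this
    linarith
  have hterm : ∀ i : ℕ, ε * θ ^ i * (κ * (ε * θ ^ (i + 1)) ^ (-a)) =
      ε ^ (1 - a) * κ / θ ^ a * (θ ^ (1 - a)) ^ i := by
    intro i
    rw [Real.mul_rpow hε.le (by positivity), pow_succ, Real.mul_rpow (by positivity) hθ.le,
      Real.rpow_neg hθ.le, sub_eq_add_neg, Real.rpow_add hε, Real.rpow_add hθ, Real.rpow_one,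
      Real.rpow_one, mul_pow, ← Real.rpow_natCast (θ ^ (-a)), ← Real.rpow_natCast θ,
      ← Real.rpow_mul hθ.le, ← Real.rpow_mul hθ.le, mul_comm (-a)]
    field_simp
  simp_rw [hterm]
  rw [← Finset.mul_sum]
  have hsum : ∑ i ∈ Finset.range n, (θ ^ (1 - a)) ^ i ≤ ((1 - a) * (1 - θ))⁻¹ := by
    refine ((summable_geometric_of_lt_one hq₀.le hq₁).sum_le_tsum _
      fun i _ => by positivity).trans ?_
    rw [tsum_geometric_of_lt_one hq₀.le hq₁]
    exact inv_anti₀ (mul_pos (by linarith) (by linarith)) hq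
  refine (mul_le_mul_of_nonneg_left hsum (by positivity)).trans_eq ?_
  have h₁ : 1 - a ≠ 0 := by linarith
  have h₂ : 1 - θ ≠ 0 := by linarith
  field_simp

lemma exists_net_Icc {x y ρ : ℝ} (hxy : x ≤ y) (hρ : 0 < ρ) :
    ∃ S : Finset ℝ, ↑S ⊆ Set.Icc x y ∧ (S.card : ℝ) ≤ 1 + (y - x) / (2 * ρ) ∧
      ∀ t ∈ Set.Icc x y, ∃ s ∈ S, |t - s| ≤ ρ := by
  classical
  refine ⟨(Finset.range (⌊(y - x) / (2 * ρ)⌋₊ + 1)).image fun i : ℕ => min (x + (2 * i + 1) * ρ) y,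
    ?_, ?_, fun t ht => ?_⟩
  · intro s hs
    obtain ⟨i, _, rfl⟩ := Finset.mem_image.1 (Finset.mem_coe.1 hs)
    exact ⟨le_min (le_add_of_nonneg_right (by positivity)) hxy, min_le_right _ _⟩
  · have h₀ : 0 ≤ (y - x) / (2 * ρ) := div_nonneg (by linarith) (by positivity)
    have h₁ := Nat.floor_le h₀
    have h₂ : (((Finset.range (⌊(y - x) / (2 * ρ)⌋₊ + 1)).image
        fun i : ℕ => min (x + (2 * i + 1) * ρ) y).card : ℝ) ≤ (⌊(y - x) / (2 * ρ)⌋₊ + 1 : ℕ) := by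
      exact_mod_cast Finset.card_image_le.trans_eq (Finset.card_range _)
    push_cast at h₂
    linarith
  · have h₀ : 0 ≤ (t - x) / (2 * ρ) := div_nonneg (by linarith [ht.1]) (by positivity)
    refine ⟨_, Finset.mem_image_of_mem _ (Finset.mem_range.2 (Nat.lt_succ_of_le
      (Nat.floor_le_floor (a := (t - x) / (2 * ρ)) ?_))), ?_⟩
    · have := ht.2
      gcongr
    · have h₁ := Nat.floor_le h₀
      have h₂ := Nat.lt_floor_add_one ((t - x) / (2 * ρ))
      rw [le_div_iff₀ (by positivity)] at h₁
      rw [div_lt_iff₀ (by positivity)] at h₂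
      have := ht.2
      rw [abs_le]
      rcases min_cases (x + (2 * (⌊(t - x) / (2 * ρ)⌋₊ : ℝ) + 1) * ρ) y with ⟨h, _⟩ | ⟨h, _⟩ <;>
        rw [h] <;> constructor <;> nlinarith

lemma one_add_le_exp_rpow_div {x p : ℝ} (hx : 0 ≤ x) (hp : 0 < p) (hp₁ : p ≤ 1) :
    1 + x ≤ Real.exp (x ^ p / p) := by
  have h : (1 + x) ^ p ≤ Real.exp (x ^ p) := by
    have h₁ := Real.rpow_add_le_add_rpow zero_le_one hx hp.le hp₁
    rw [Real.one_rpow] at h₁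
    linarith [Real.add_one_le_exp (x ^ p)]
  rw [div_eq_mul_inv, Real.exp_mul]
  calc 1 + x = ((1 + x) ^ p) ^ p⁻¹ := (Real.rpow_rpow_inv (by positivity) hp.ne').symm
    _ ≤ _ := by gcongr

/-- A net of radius `r` in a rectangle, for the anisotropic metric. -/
lemma exists_net_anisoDist {x y A H₁ H₂ r : ℝ} (hxy : x ≤ y) (hA : 0 ≤ A) (hH₁ : 0 < H₁ ∧ H₁ ≤ 1)
    (hH₂ : 0 < H₂ ∧ H₂ ≤ 1) (hr : 0 < r) :
    ∃ S : Finset (ℝ × ℝ), ↑S ⊆ Set.Icc x y ×ˢ Set.Icc (-A) A ∧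
      (S.card : ℝ) ≤ Real.exp ((1 / H₁ * ((y - x) / 2) ^ H₁ + 1 / H₂ * A ^ H₂) * (2 / r)) ∧
      ∀ t ∈ Set.Icc x y ×ˢ Set.Icc (-A) A, ∃ s ∈ S, anisoDist H₁ H₂ t s ≤ r := by
  have hcard : ∀ {z H : ℝ}, 0 ≤ z → 0 < H → H ≤ 1 →
      1 + 2 * z / (2 * (r / 2) ^ H⁻¹) ≤ Real.exp (1 / H * z ^ H * (2 / r)) := by
    intro z H hz hH hH₁
    refine (one_add_le_exp_rpow_div (by positivity) hH hH₁).trans_eq ?_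
    rw [mul_div_mul_left _ _ two_ne_zero, Real.div_rpow hz (by positivity),
      Real.rpow_inv_rpow (by positivity) hH.ne']
    congr 1
    field_simp
  have hdist : ∀ {u H : ℝ}, 0 < H → |u| ≤ (r / 2) ^ H⁻¹ → |u| ^ H ≤ r / 2 := by
    intro u H hH hu
    calc |u| ^ H ≤ ((r / 2) ^ H⁻¹) ^ H := by gcongr
      _ = r / 2 := Real.rpow_inv_rpow (by positivity) hH.ne'
  obtain ⟨S₁, hS₁, hc₁, hn₁⟩ := exists_net_Icc hxy (ρ := (r / 2) ^ H₁⁻¹) (by positivity)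
  obtain ⟨S₂, hS₂, hc₂, hn₂⟩ := exists_net_Icc (show -A ≤ A by linarith) (ρ := (r / 2) ^ H₂⁻¹)
    (by positivity)
  refine ⟨S₁ ×ˢ S₂, ?_, ?_, ?_⟩
  · rw [Finset.coe_product]
    exact Set.prod_mono hS₁ hS₂
  · have h₁ := hcard (z := (y - x) / 2) (by linarith) hH₁.1 hH₁.2
    have h₂ := hcard hA hH₂.1 hH₂.2
    rw [mul_div_cancel₀ _ two_ne_zero] at h₁
    rw [sub_neg_eq_add, ← two_mul] at hc₂
    rw [Finset.card_product, Nat.cast_mul, add_mul, Real.exp_add]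
    exact mul_le_mul (hc₁.trans h₁) (hc₂.trans h₂) (by positivity) (by positivity)
  · rintro t ⟨ht₁, ht₂⟩
    obtain ⟨s₁, hs₁, h₁⟩ := hn₁ _ ht₁
    obtain ⟨s₂, hs₂, h₂⟩ := hn₂ _ ht₂
    refine ⟨(s₁, s₂), Finset.mk_mem_product hs₁ hs₂, ?_⟩
    have := hdist hH₁.1 h₁
    have := hdist hH₂.1 h₂
    simp only [anisoDist]
    linarith

lemma entropy_rpow_le {z A H₁ H₂ β γ cst v : ℝ} (hz : 0 ≤ z) (hA : 0 ≤ A) (hH₁ : 0 < H₁ ∧ H₁ ≤ 1)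
    (hH₂ : 0 < H₂ ∧ H₂ ≤ 1) (hβ : 1 ≤ β) (hc : 0 < cst) (hv : 0 < v) :
    ((1 / H₁ * z ^ H₁ + 1 / H₂ * A ^ H₂) * (2 / (v / cst) ^ (1 / γ))) ^ (1 / β) ≤
      (1 / H₁ * z ^ (H₁ / β) + 1 / H₂ * A ^ (H₂ / β)) * (2 ^ (1 / β) * cst ^ (1 / (γ * β))) *
        v ^ (-(1 / (γ * β))) := by
  have hβ₀ : 0 < β := by linarith
  have hβ₁ : 1 / β ≤ 1 := (div_le_one hβ₀).2 hβ
  obtain ⟨hH₁, hH₁'⟩ := hH₁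
  obtain ⟨hH₂, hH₂'⟩ := hH₂
  have hterm : ∀ {z H : ℝ}, 0 ≤ z → 0 < H → H ≤ 1 →
      (1 / H * z ^ H) ^ (1 / β) ≤ 1 / H * z ^ (H / β) := by
    intro z H hz hH hH'
    rw [Real.mul_rpow (by positivity) (by positivity), ← Real.rpow_mul hz, mul_one_div]
    gcongr
    exact Real.rpow_le_self_of_one_le ((one_le_div hH).2 hH') hβ₁
  have hr : (2 / (v / cst) ^ (1 / γ)) ^ (1 / β) =
      2 ^ (1 / β) * cst ^ (1 / (γ * β)) * v ^ (-(1 / (γ * β))) := by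
    rw [Real.div_rpow zero_le_two (by positivity), ← Real.rpow_mul (by positivity),
      Real.div_rpow hv.le hc.le, Real.rpow_neg hv.le, one_div_mul_one_div]
    field_simp
  rw [Real.mul_rpow (by positivity) (by positivity), hr, ← mul_assoc, ← mul_assoc, ← mul_assoc]
  gcongr
  refine (Real.rpow_add_le_add_rpow (by positivity) (by positivity) (by positivity) hβ₁).trans ?_
  exact add_le_add (hterm hz hH₁ hH₁') (hterm hA hH₂ hH₂')

section

variable {Ω : Type*} [MeasurableSpace Ω] {P : Measure Ω} {α : ℝ}

lemma IsPhiSubGaussian.exists_hasPowerMgfBound {Y : Ω → ℝ}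
    (h : IsPhiSubGaussian P (powerOrlicz α) Y) : ∃ a, 0 < a ∧ HasPowerMgfBound P α Y a := by
  obtain ⟨a, ha, hb⟩ := h.exists_bound
  refine ⟨a, ha, h.integrable.aemeasurable, fun l => ?_⟩
  rw [← ofReal_integral_eq_lintegral_ofReal (h.integrable_exp l)
    (Eventually.of_forall fun _ => (Real.exp_pos _).le)]
  exact ENNReal.ofReal_le_ofReal (hb l)

namespace HasPowerMgfBound

lemma sub {Y Z : Ω → ℝ} {τ : ℝ} (hY : HasPowerMgfBound P α Y τ) (hZ : HasPowerMgfBound P α Z τ) :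
    HasPowerMgfBound P α (fun ω => Y ω - Z ω) (2 * τ) := by
  have mY := hY.aemeasurable
  have mZ := hZ.aemeasurable
  refine ⟨mY.sub mZ, fun l => ?_⟩
  have h₁ := hY.bound (2 * l)
  have h₂ := hZ.bound (-(2 * l))
  rw [neg_mul, abs_neg] at h₂
  have := lintegral_exp_convex (w₁ := 1 / 2) (w₂ := 1 / 2) (by fun_prop)
    (by norm_num) (by norm_num) (by norm_num) h₁ h₂
  convert this using 5
  · ring
  · ring_nf

lemma integrable_exp {Y : Ω → ℝ} {τ : ℝ} (h : HasPowerMgfBound P α Y τ) (l : ℝ) :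
    Integrable (fun ω => Real.exp (l * Y ω)) P := by
  have := h.aemeasurable
  refine ⟨(show AEMeasurable (fun ω => Real.exp (l * Y ω)) P by fun_prop).aestronglyMeasurable, ?_⟩
  rw [hasFiniteIntegral_iff_ofReal (Eventually.of_forall fun _ => (Real.exp_pos _).le)]
  exact (h.bound l).trans_lt ENNReal.ofReal_lt_top

lemma integral_exp_le {Y : Ω → ℝ} {τ : ℝ} (h : HasPowerMgfBound P α Y τ) (l : ℝ) :
    ∫ ω, Real.exp (l * Y ω) ∂P ≤ Real.exp (|l * τ| ^ α / α) := by
  rw [← ENNReal.ofReal_le_ofReal_iff (Real.exp_pos _).le, ofReal_integral_eq_lintegral_ofReal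
    (h.integrable_exp l) (Eventually.of_forall fun _ => (Real.exp_pos _).le)]
  exact h.bound l

lemma of_phiNorm_le {Y : Ω → ℝ} {a τ : ℝ} (h : HasPowerMgfBound P α Y a) (ha : 0 < a)
    (hα : 0 < α) (hτ : phiNorm P (powerOrlicz α) Y ≤ τ) : HasPowerMgfBound P α Y τ := by
  refine ⟨h.aemeasurable, fun l => ?_⟩
  rw [← ofReal_integral_eq_lintegral_ofReal (h.integrable_exp l)
    (Eventually.of_forall fun _ => (Real.exp_pos _).le)]
  refine ENNReal.ofReal_le_ofReal ?_
  have hτ₀ : 0 ≤ τ := (Real.sInf_nonneg fun x hx => hx.1.le).trans hτ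
  have hlim : Tendsto (fun η : ℝ => Real.exp (|l * (τ + η)| ^ α / α)) (𝓝[>] 0)
      (𝓝 (Real.exp (|l * (τ + 0)| ^ α / α))) := by
    refine Continuous.continuousWithinAt ?_
    have : Continuous fun η : ℝ => |l * (τ + η)| ^ α :=
      Continuous.rpow_const (by fun_prop) fun _ => Or.inr hα.le
    fun_prop
  rw [add_zero] at hlim
  refine ge_of_tendsto hlim ?_
  filter_upwards [self_mem_nhdsWithin] with η hη
  obtain ⟨x, ⟨hx, hxb⟩, hxη⟩ := exists_lt_of_csInf_lt (s := {a : ℝ | 0 < a ∧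
      ∀ l : ℝ, ∫ ω, Real.exp (l * Y ω) ∂P ≤ Real.exp (powerOrlicz α (a * l))})
    ⟨a, ha, fun l => by simpa [powerOrlicz, mul_comm a] using h.integral_exp_le l⟩
    (show phiNorm P (powerOrlicz α) Y < τ + η from hτ.trans_lt (lt_add_of_pos_right τ hη))
  refine (hxb l).trans ?_
  have : |x * l| ≤ |l * (τ + η)| := by
    rw [abs_mul, abs_mul, abs_of_pos hx, abs_of_pos (hx.trans hxη), mul_comm]
    gcongr
  unfold powerOrlicz
  gcongr

end HasPowerMgfBound

lemma hasExpBound_finsetAbsSup_stripBlock [IsProbabilityMeasure P] {β A H₁ H₂ γ E θ : ℝ} {b ck : ℕ → ℝ}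
    {X : ℝ × ℝ → Ω → ℝ} {k : ℕ} (hα : 1 < α) (hβ : 1 / β = 1 - 1 / α) (hβ₁ : 1 ≤ β) (hA : 0 ≤ A)
    (hH₁ : 0 < H₁ ∧ H₁ ≤ 1) (hH₂ : 0 < H₂ ∧ H₂ ≤ 1) (hb : b k ≤ b (k + 1))
    (hX : ∀ t ∈ stripBlock b A k, IsPhiSubGaussian P (powerOrlicz α) (X t))
    (hck : 0 < ck k) (hγ : 0 < γ) (hγβ : 1 < γ * β)
    (hincr : ∀ h : ℝ, 0 < h → ∀ t ∈ stripBlock b A k, ∀ s ∈ stripBlock b A k,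
      anisoDist H₁ H₂ t s ≤ h →
        phiNorm P (powerOrlicz α) (fun ω => X t ω - X s ω) ≤ ck k * h ^ γ)
    (hE : 0 < E) (hXE : ∀ t ∈ stripBlock b A k, phiNorm P (powerOrlicz α) (X t) ≤ E)
    (hθ : 0 < θ) (hθ₁ : θ < 1) {F : Finset (ℝ × ℝ)} (hF : ↑F ⊆ stripBlock b A k) :
    HasExpBound P α (finsetAbsSup F X) (E / (1 - θ)) (2 * (E ^ (1 - 1 / (γ * β)) *
      blockConst H₁ H₂ γ β ck b A k / ((1 - θ) * θ ^ (1 / (γ * β))))) := by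
  have hα₀ : 0 < α := by linarith
  have hl : 0 ≤ (b (k + 1) - b k) / 2 := by linarith
  set κ := (1 / H₁ * ((b (k + 1) - b k) / 2) ^ (H₁ / β) + 1 / H₂ * A ^ (H₂ / β)) *
    (2 ^ (1 / β) * ck k ^ (1 / (γ * β))) with hκ
  have hH₁₀ := hH₁.1
  have hH₂₀ := hH₂.1
  have hbound : ∀ t ∈ stripBlock b A k, HasPowerMgfBound P α (X t) E := fun t ht => by
    obtain ⟨a, ha, h⟩ := (hX t ht).exists_hasPowerMgfBound
    exact h.of_phiNorm_le ha hα₀ (hXE t ht)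
  have hr : ∀ n : ℕ, 0 < (E * θ ^ (n + 1) / ck k) ^ (1 / γ) := fun n => by positivity
  choose S hS hcard hnet using fun n => exists_net_anisoDist hb hA hH₁ hH₂ (hr n)
  have hblock : blockConst H₁ H₂ γ β ck b A k = κ / (1 - 1 / (γ * β)) := by
    rw [hκ, blockConst, mul_div_assoc, mul_div_assoc, mul_div_assoc]
  rw [hblock]
  refine hasExpBound_finsetAbsSup_of_nets hα hβ hE hθ hθ₁ hbound hS (fun n t ht => ?_)
    (fun n => by positivity) hcard (fun n => ?_) hF
  · obtain ⟨s, hs, hts⟩ := hnet n t ht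
    refine ⟨s, hs, ?_⟩
    have hinc := hincr _ (hr n) t ht s (hS n hs) hts
    rw [one_div, Real.rpow_inv_rpow (by positivity) hγ.ne', mul_div_cancel₀ _ hck.ne'] at hinc
    exact ((hbound t ht).sub (hbound s (hS n hs))).of_phiNorm_le (by positivity) hα₀ hinc
  · refine le_trans (Finset.sum_le_sum fun i _ => mul_le_mul_of_nonneg_left
      (entropy_rpow_le (γ := γ) hl hA hH₁ hH₂ hβ₁ hck (by positivity)) (by positivity)) ?_
    exact sum_geometric_entropy_le hE hθ hθ₁ (by positivity)
      ((div_lt_one (by linarith)).2 hγβ) (by positivity) n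

lemma hasExpBound_sum {M : ℕ → Ω → ℝ} {T e : ℕ → ℝ} (hT : ∀ k, 0 < T k)
    (h : ∀ k, HasExpBound P α (M k) (T k) (e k)) (n : ℕ) :
    HasExpBound P α (fun ω => ∑ k ∈ Finset.range (n + 1), M k ω) (∑ k ∈ Finset.range (n + 1), T k)
      (∑ k ∈ Finset.range (n + 1), e k) := by
  induction n with
  | zero => simpa using h 0
  | succ n ih =>
    simp_rw [Finset.sum_range_succ _ (n + 1)]
    exact ih.add (h _) (Finset.sum_pos (fun i _ => hT i) (by simp)) (hT _)

lemma exists_mem_stripBlock {A : ℝ} {b : ℕ → ℝ} (hb₀ : b 0 = 0) (hb : Tendsto b atTop atTop)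
    {t : ℝ × ℝ} (ht : t ∈ halfStrip A) : ∃ k, t ∈ stripBlock b A k := by
  classical
  have hex : ∃ j, t.1 < b j := (hb.eventually_gt_atTop t.1).exists
  have h₀ : Nat.find hex ≠ 0 := fun h => by
    have := Nat.find_spec hex
    rw [h, hb₀] at this
    exact absurd ht.1 (not_le.2 this)
  obtain ⟨k, hk⟩ := Nat.exists_eq_succ_of_ne_zero h₀
  refine ⟨k, ⟨not_lt.1 (Nat.find_min hex (by omega)), ?_⟩, ht.2⟩
  have := Nat.find_spec hex
  rw [hk] at this
  exact this.le

/-- The combination of bounds over the blocks: `|X t| / f t.1` over a finite set. -/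
lemma hasExpBound_finsetAbsSup_halfStrip {A T₀ e₀ : ℝ} {f : ℝ → ℝ} {b : ℕ → ℝ}
    {T e : ℕ → ℝ} {X : ℝ × ℝ → Ω → ℝ} (hα : 0 < α)
    (hf_mono : MonotoneOn f (Set.Ici 0)) (hf_pos : ∀ x, 0 ≤ x → 0 < f x)
    (hb₀ : b 0 = 0) (hb : ∀ k, 0 ≤ b k) (hb_top : Tendsto b atTop atTop)
    (hX : ∀ t ∈ halfStrip A, AEMeasurable (X t) P) (hT : ∀ k, 0 < T k)
    (hblock : ∀ k, ∀ F : Finset (ℝ × ℝ), ↑F ⊆ stripBlock b A k →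
      HasExpBound P α (finsetAbsSup F X) (T k) (e k))
    (hT₀ : ∀ n, ∑ k ∈ Finset.range n, 1 / f (b k) * T k ≤ T₀)
    (he₀ : ∀ n, ∑ k ∈ Finset.range n, 1 / f (b k) * e k ≤ e₀)
    {F : Finset (ℝ × ℝ)} (hF : ↑F ⊆ halfStrip A) :
    HasExpBound P α (finsetAbsSup F fun t ω => X t ω / f t.1) T₀ e₀ := by
  classical
  have hfb : ∀ k, 0 < 1 / f (b k) := fun k => one_div_pos.2 (hf_pos _ (hb k))
  have hex : ∀ t : ℝ × ℝ, ∃ k, t ∈ halfStrip A → t ∈ stripBlock b A k := fun t => by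
    by_cases ht : t ∈ halfStrip A
    · obtain ⟨k, hk⟩ := exists_mem_stripBlock hb₀ hb_top ht
      exact ⟨k, fun _ => hk⟩
    · exact ⟨0, fun h => absurd h ht⟩
  choose κ hκ using hex
  have hFk : ∀ k, ↑(F.filter fun t => κ t = k) ⊆ stripBlock b A k := fun k t ht => by
    obtain ⟨htF, rfl⟩ := Finset.mem_filter.1 (Finset.mem_coe.1 ht)
    exact hκ t (hF htF)
  have hsum := hasExpBound_sum (fun k => mul_pos (hfb k) (hT k))
    (fun k => (hblock k _ (hFk k)).const_mul (hfb k)) (F.sup κ)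
  refine hsum.mono hα (aemeasurable_finsetAbsSup fun t ht => (hX t (hF ht)).div_const _)
    (fun ω => ?_) (Finset.sum_nonneg fun k _ => (mul_pos (hfb k) (hT k)).le) (hT₀ _) (he₀ _)
  have hnn : ∀ k, 0 ≤ 1 / f (b k) * finsetAbsSup (F.filter fun t => κ t = k) X ω := fun k =>
    mul_nonneg (hfb k).le (finsetAbsSup_nonneg _ _ _)
  refine finsetAbsSup_le (Finset.sum_nonneg fun k _ => hnn k) fun t ht => ?_
  have htb := hκ t (hF ht)
  refine le_trans ?_ (Finset.single_le_sum (fun k _ => hnn k)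
    (Finset.mem_range.2 (Nat.lt_succ_of_le (Finset.le_sup (f := κ) ht))))
  rw [abs_div, abs_of_pos (hf_pos _ (hF ht).1), div_eq_mul_one_div, mul_comm]
  have h₁ := hf_mono (hb _) (hF ht).1 htb.1.1
  have h₂ := hf_pos _ (hb (κ t))
  have h₃ := abs_le_finsetAbsSup X ω (Finset.mem_filter.2 ⟨ht, rfl⟩ : t ∈ F.filter fun s => κ s = κ t)
  have := hfb (κ t)
  gcongr

end

section

variable {Ω : Type*}

/-- A separating set determines the weighted supremum, for a continuous positive weight. -/
lemma weightedSup_le_of_separating {D : Set (ℝ × ℝ)} {A : ℝ} {X : ℝ × ℝ → Ω → ℝ} {f : ℝ → ℝ} {ω : Ω}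
    (hD : D ⊆ halfStrip A) (hf_cont : ContinuousOn f (Set.Ici 0))
    (hf_pos : ∀ x, 0 ≤ x → 0 < f x)
    (h : ∀ U : Set (ℝ × ℝ), IsOpen U → ∀ F : Set ℝ, IsClosed F →
      (∀ t ∈ D ∩ U, X t ω ∈ F) → ∀ t ∈ halfStrip A ∩ U, X t ω ∈ F) :
    weightedSup (halfStrip A) X f ω ≤ weightedSup D X f ω := by
  refine iSup₂_le fun t ht => ?_
  by_contra! hlt
  obtain ⟨x, hx, hxt⟩ := EReal.lt_iff_exists_real_btwn.1 hlt
  rw [EReal.coe_lt_coe_iff, lt_div_iff₀ (hf_pos _ ht.1)] at hxt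
  obtain ⟨y, hy, hyt⟩ := exists_between hxt
  have hev : ∀ᶠ s in 𝓝[Set.Ici 0 ×ˢ Set.univ] t, x * f s.1 < y := by
    have hc : ContinuousOn (fun s : ℝ × ℝ => x * f s.1) (Set.Ici 0 ×ˢ Set.univ) :=
      continuousOn_const.mul (hf_cont.comp continuousOn_fst fun s hs => hs.1)
    exact (hc t ⟨ht.1, trivial⟩).eventually_lt_const hy
  obtain ⟨U, hU, htU, hUs⟩ := mem_nhdsWithin.1 hev
  have hmem := h U hU (Set.Icc (-y) y) isClosed_Icc (fun s hs => ?_) t ⟨ht, htU⟩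
  · exact absurd (abs_le.2 hmem) (not_le.2 hyt)
  · have hs₀ : 0 ≤ s.1 := (hD hs.1).1
    have h₁ : x * f s.1 < y := hUs ⟨hs.2, hs₀, trivial⟩
    have h₂ : ((|X s ω| / f s.1 : ℝ) : EReal) < x :=
      (le_iSup₂ (f := fun t (_ : t ∈ D) => ((|X t ω| / f t.1 : ℝ) : EReal)) s hs.1).trans_lt hx
    rw [EReal.coe_lt_coe_iff, div_lt_iff₀ (hf_pos _ hs₀)] at h₂
    exact abs_le.1 (h₂.trans h₁).le

variable [MeasurableSpace Ω] {P : Measure Ω}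

lemma aemeasurable_weightedSup {D : Set (ℝ × ℝ)} (hD : D.Countable) {X : ℝ × ℝ → Ω → ℝ} {f : ℝ → ℝ}
    (hX : ∀ t ∈ D, AEMeasurable (X t) P) : AEMeasurable (weightedSup D X f) P := by
  refine AEMeasurable.biSup D hD fun t ht => ?_
  have := hX t ht
  exact (measurable_coe_real_ereal.comp_aemeasurable (by fun_prop))

lemma aemeasurable_exp_mul {W : Ω → EReal} (hW : AEMeasurable W P) (l : ℝ) :
    AEMeasurable (fun ω => EReal.exp ((l : EReal) * W ω)) P := by
  simp_rw [mul_comm (l : EReal), EReal.exp_mul]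
  exact (EReal.measurable_exp.comp_aemeasurable hW).pow_const l

/-- Passage from finite subsets to a countable set. -/
lemma lintegral_exp_weightedSup_le {α T e l : ℝ} {D : Set (ℝ × ℝ)} (hD : D.Countable)
    (hDne : D.Nonempty) {X : ℝ × ℝ → Ω → ℝ} {f : ℝ → ℝ} (hf : ∀ t ∈ D, 0 < f t.1)
    (h : ∀ F : Finset (ℝ × ℝ), ↑F ⊆ D →
      HasExpBound P α (finsetAbsSup F fun t ω => X t ω / f t.1) T e) (hl : 0 < l) :
    ∫⁻ ω, EReal.exp ((l : EReal) * weightedSup D X f ω) ∂P ≤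
      ENNReal.ofReal (2 * Real.exp ((l * T) ^ α / α + l * e)) := by
  classical
  obtain ⟨g, rfl⟩ := hD.exists_eq_range hDne
  set F : ℕ → Finset (ℝ × ℝ) := fun n => (Finset.range (n + 1)).image g with hFdef
  have hF : ∀ n, ↑(F n) ⊆ Set.range g := fun n t ht => by
    obtain ⟨i, _, rfl⟩ := Finset.mem_image.1 (Finset.mem_coe.1 ht)
    exact ⟨i, rfl⟩
  set M : ℕ → Ω → ℝ := fun n => finsetAbsSup (F n) fun t ω => X t ω / f t.1 with hM
  have hmono : ∀ ω, Monotone fun n => (M n ω : EReal) := fun ω m n hmn => by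
    refine EReal.coe_le_coe_iff.2 (finsetAbsSup_le (finsetAbsSup_nonneg _ _ _) fun t ht =>
      abs_le_finsetAbsSup (fun t ω => X t ω / f t.1) ω ?_)
    exact Finset.image_subset_image (Finset.range_subset_range.2 (by omega)) ht
  have hsup : ∀ ω, weightedSup (Set.range g) X f ω ≤ ⨆ n, (M n ω : EReal) := fun ω => by
    refine iSup₂_le fun t ht => ?_
    obtain ⟨i, rfl⟩ := ht
    refine le_trans (EReal.coe_le_coe_iff.2 ?_) (le_iSup (fun n => (M n ω : EReal)) i)
    have := abs_le_finsetAbsSup (F := F i) (fun t ω => X t ω / f t.1) ω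
      (Finset.mem_image_of_mem g (Finset.self_mem_range_succ i))
    rwa [abs_div, abs_of_pos (hf _ ⟨i, rfl⟩)] at this
  have hlim : ∀ ω, Tendsto (fun n => EReal.exp ((l : EReal) * M n ω)) atTop
      (𝓝 (EReal.exp ((l : EReal) * ⨆ n, (M n ω : EReal)))) := fun ω => by
    have := tendsto_atTop_iSup (hmono ω)
    simp_rw [mul_comm (l : EReal), EReal.exp_mul]
    exact (ENNReal.continuous_rpow_const.tendsto _).comp
      ((ENNReal.continuous_exp.tendsto _).comp this)
  calc ∫⁻ ω, EReal.exp ((l : EReal) * weightedSup (Set.range g) X f ω) ∂P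
      ≤ ∫⁻ ω, liminf (fun n => EReal.exp ((l : EReal) * M n ω)) atTop ∂P := by
        refine lintegral_mono fun ω => ?_
        rw [(hlim ω).liminf_eq]
        exact EReal.exp_monotone (mul_le_mul_of_nonneg_left (hsup ω) (EReal.coe_nonneg.2 hl.le))
    _ ≤ liminf (fun n => ∫⁻ ω, EReal.exp ((l : EReal) * M n ω) ∂P) atTop :=
        lintegral_liminf_le' fun n => aemeasurable_exp_mul
          (measurable_coe_real_ereal.comp_aemeasurable (h _ (hF n)).aemeasurable) l
    _ ≤ liminf (fun _ : ℕ => ENNReal.ofReal (2 * Real.exp ((l * T) ^ α / α + l * e))) atTop := by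
        refine liminf_le_liminf (Eventually.of_forall fun n => ?_)
        simp_rw [← EReal.coe_mul, EReal.exp_coe]
        exact (h _ (hF n)).bound l hl
    _ = _ := liminf_const _

/-- The Chernoff bound with the optimal parameter. -/
lemma measure_lt_le_of_lintegral_exp_le {W : Ω → EReal} (hW : AEMeasurable W P) {α β T e u : ℝ}
    (hα : 1 < α) (hβ : β = α / (α - 1)) (hT : 0 < T)
    (h : ∀ l : ℝ, 0 < l → ∫⁻ ω, EReal.exp ((l : EReal) * W ω) ∂P ≤
      ENNReal.ofReal (2 * Real.exp ((l * T) ^ α / α + l * e))) (hu : e < u) :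
    P {ω | (u : EReal) < W ω} ≤ ENNReal.ofReal (2 * Real.exp (-(((u - e) / T) ^ β / β))) := by
  have hα₁ : 0 < α - 1 := by linarith
  have hα₀ : 0 < α := by linarith
  set z := (u - e) / T with hz
  have hz₀ : 0 < z := div_pos (by linarith) hT
  set l := z ^ (β - 1) / T with hl
  have hl₀ : 0 < l := by positivity
  have hlT : l * T = z ^ (β - 1) := by rw [hl]; field_simp
  have hlα : (l * T) ^ α = z ^ β := by
    rw [hlT, ← Real.rpow_mul hz₀.le]
    congr 1
    rw [hβ]
    field_simp
    ring
  have hlu : l * (u - e) = z ^ β := by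
    have : u - e = T * z := by rw [hz]; field_simp
    rw [this, ← mul_assoc, hlT, ← Real.rpow_add_one hz₀.ne']
    ring_nf
  have hmarkov := (mul_meas_ge_le_lintegral₀ (aemeasurable_exp_mul hW l)
    (ENNReal.ofReal (Real.exp (l * u)))).trans (h l hl₀)
  have hsub : P {ω | (u : EReal) < W ω} ≤
      P {ω | ENNReal.ofReal (Real.exp (l * u)) ≤ EReal.exp ((l : EReal) * W ω)} := by
    refine measure_mono fun ω hω => ?_
    rw [Set.mem_ofPred_eq, ← EReal.exp_coe, EReal.coe_mul]
    exact EReal.exp_monotone (mul_le_mul_of_nonneg_left (le_of_lt hω) (EReal.coe_nonneg.2 hl₀.le))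
  refine hsub.trans ?_
  rw [mul_comm, ← ENNReal.le_div_iff_mul_le (Or.inl (by simp [Real.exp_pos]))
    (Or.inl ENNReal.ofReal_ne_top), ← ENNReal.ofReal_div_of_pos (Real.exp_pos _), mul_div_assoc,
    ← Real.exp_sub] at hmarkov
  refine hmarkov.trans_eq ?_
  congr 3
  have : (l * T) ^ α / α + l * e - l * u = z ^ β / α - z ^ β := by rw [hlα, ← hlu]; ring
  rw [this, hβ]
  field_simp
  ring

end

theorem mainTheorem3 {Ω : Type*} [MeasurableSpace Ω] (P : Measure Ω) [IsProbabilityMeasure P]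
    (α β A H₁ H₂ γ δ c C S : ℝ) (f : ℝ → ℝ) (b ck : ℕ → ℝ) (X : ℝ × ℝ → Ω → ℝ)
    (hα : 1 < α ∧ α ≤ 2) (hβ : β = α / (α - 1)) (hA : 0 ≤ A)
    (hH₁ : 0 < H₁ ∧ H₁ ≤ 1) (hH₂ : 0 < H₂ ∧ H₂ ≤ 1)
    -- the weight and the partition of the half-line
    (hf_cont : ContinuousOn f (Set.Ici 0)) (hf_mono : StrictMonoOn f (Set.Ici 0))
    (hf_pos : ∀ x, 0 ≤ x → 0 < f x) (hf_top : Tendsto f atTop atTop)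
    (hb_zero : b 0 = 0) (hb_mono : StrictMono b) (hb_top : Tendsto b atTop atTop)
    -- the field
    (hX_sub : ∀ t ∈ halfStrip A, IsPhiSubGaussian P (powerOrlicz α) (X t))
    (hX_sep : IsSeparableField P (halfStrip A) X)
    (hε : ∀ k, 0 < blockEps P (powerOrlicz α) X b A k)
    -- (i)
    (hck : ∀ k, 0 < ck k) (hγ : 0 < γ ∧ γ ≤ 1) (hγβ : 1 < γ * β)
    (h_incr : ∀ k, ∀ h : ℝ, 0 < h → ∀ t ∈ stripBlock b A k, ∀ s ∈ stripBlock b A k,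
      anisoDist H₁ H₂ t s ≤ h →
        phiNorm P (powerOrlicz α) (fun ω => X t ω - X s ω) ≤ ck k * h ^ γ)
    -- (ii)
    (hδ : 0 < δ) (hc : 0 < c)
    (h_growth : ∀ t ∈ halfStrip A, phiNorm P (powerOrlicz α) (X t) ≤ c * t.1 ^ δ)
    -- (iii)
    (hC_sum : Summable fun k => b (k + 1) ^ δ / f (b k))
    (hC : C = c * ∑' k, b (k + 1) ^ δ / f (b k))
    -- (iv)
    (hS_sum : Summable fun k =>
      b (k + 1) ^ (δ * (1 - 1 / (γ * β))) * blockConst H₁ H₂ γ β ck b A k / f (b k))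
    (hS : S = c ^ (1 - 1 / (γ * β)) * ∑' k,
      b (k + 1) ^ (δ * (1 - 1 / (γ * β))) * blockConst H₁ H₂ γ β ck b A k / f (b k)) :
    AEMeasurable (weightedSup (halfStrip A) X f) P ∧
    (∀ θ : ℝ, 0 < θ → θ < min 1 (thetaTilde P (powerOrlicz α) X H₁ H₂ γ ck b A) →
      (∀ l : ℝ, 0 < l →
        ∫⁻ ω, EReal.exp ((l : EReal) * weightedSup (halfStrip A) X f ω) ∂P ≤
          ENNReal.ofReal (2 * Real.exp (l ^ α / α * (C / (1 - θ)) ^ α +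
            2 * l / ((1 - θ) * θ ^ (1 / (γ * β))) * S))) ∧
      (∀ u : ℝ, 2 * S / ((1 - θ) * θ ^ (1 / (γ * β))) < u →
        P {ω | (u : EReal) < weightedSup (halfStrip A) X f ω} ≤
          ENNReal.ofReal (2 * Real.exp (-(1 / (β * C ^ β) *
            (u * (1 - θ) - 2 * S * θ ^ (-(1 / (γ * β)))) ^ β))))) := by
  obtain ⟨hα₁, -⟩ := hα
  have hα₀ : 0 < α := by linarith
  have hα₂ : α - 1 ≠ 0 := by linarith
  have hβ' : 1 / β = 1 - 1 / α := by rw [hβ]; field_simp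
  have hβ₁ : 1 ≤ β := by rw [hβ, le_div_iff₀ (by linarith)]; linarith
  have hβ₀ : 0 < β := by linarith
  have hb : ∀ k, 0 ≤ b k := fun k => hb_zero ▸ hb_mono.monotone (Nat.zero_le k)
  have hbs : ∀ k, 0 < b (k + 1) := fun k => (hb k).trans_lt (hb_mono k.lt_succ_self)
  have hfb : ∀ k, 0 < f (b k) := fun k => hf_pos _ (hb k)
  have hsub : ∀ k, stripBlock b A k ⊆ halfStrip A := fun k =>
    Set.prod_mono (fun x hx => (hb k).trans hx.1) subset_rfl
  have hXm : ∀ t ∈ halfStrip A, AEMeasurable (X t) P := fun t ht =>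
    (hX_sub t ht).integrable.aemeasurable
  have hCterm : ∀ k, 0 < b (k + 1) ^ δ / f (b k) := fun k =>
    div_pos (Real.rpow_pos_of_pos (hbs k) _) (hfb k)
  have hC₀ : 0 < C := by
    rw [hC]
    exact mul_pos hc (hC_sum.tsum_pos (fun k => (hCterm k).le) 0 (hCterm 0))
  have hconst : ∀ k, 0 ≤ blockConst H₁ H₂ γ β ck b A k := fun k => by
    have h₁ : 0 ≤ (b (k + 1) - b k) / 2 := by linarith [hb_mono k.lt_succ_self]
    have h₂ : 1 / (γ * β) ≤ 1 := (div_le_one (by linarith)).2 hγβ.le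
    have h₃ := hck k
    have h₄ := hH₁.1
    have h₅ := hH₂.1
    have h₆ : 0 ≤ 1 - 1 / (γ * β) := by linarith
    unfold blockConst
    positivity
  obtain ⟨D, hDc, hDV, hDd, hD⟩ := hX_sep
  have hDne : D.Nonempty := by
    have h₀ : ((0, 0) : ℝ × ℝ) ∈ halfStrip A := ⟨le_refl (0 : ℝ), by simpa using hA⟩
    exact closure_nonempty_iff.1 ⟨_, hDd h₀⟩
  have hW : weightedSup (halfStrip A) X f =ᵐ[P] weightedSup D X f := by
    filter_upwards [hD] with ω hω
    refine le_antisymm (weightedSup_le_of_separating hDV hf_cont hf_pos hω) ?_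
    exact biSup_mono fun t ht => hDV ht
  have hWm : AEMeasurable (weightedSup (halfStrip A) X f) P :=
    (aemeasurable_weightedSup hDc fun t ht => hXm t (hDV ht)).congr hW.symm
  refine ⟨hWm, fun θ hθ hθ_lt => ?_⟩
  have hθ₁ : θ < 1 := hθ_lt.trans_le (min_le_left _ _)
  have h1θ : 0 < 1 - θ := by linarith
  set a := 1 / (γ * β) with ha
  have hθa : 0 < θ ^ a := by positivity
  have hT : ∀ k, 0 < c * b (k + 1) ^ δ := fun k => mul_pos hc (Real.rpow_pos_of_pos (hbs k) _)
  have hblock : ∀ k, ∀ F : Finset (ℝ × ℝ), ↑F ⊆ stripBlock b A k → HasExpBound P α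
      (finsetAbsSup F X) (c * b (k + 1) ^ δ / (1 - θ)) (2 * ((c * b (k + 1) ^ δ) ^ (1 - a) *
        blockConst H₁ H₂ γ β ck b A k / ((1 - θ) * θ ^ a))) := fun k F hF => by
    refine hasExpBound_finsetAbsSup_stripBlock hα₁ hβ' hβ₁ hA hH₁ hH₂
      (hb_mono k.lt_succ_self).le (fun t ht => hX_sub t (hsub k ht)) (hck k) hγ.1 hγβ (h_incr k)
      (hT k) (fun t ht => (h_growth t (hsub k ht)).trans ?_) hθ hθ₁ hF
    have := (hsub k ht).1
    have := ht.1.2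
    gcongr
  have hbound : ∀ F : Finset (ℝ × ℝ), ↑F ⊆ D →
      HasExpBound P α (finsetAbsSup F fun t ω => X t ω / f t.1) (C / (1 - θ))
        (2 * S / ((1 - θ) * θ ^ a)) := fun F hF => by
    refine hasExpBound_finsetAbsSup_halfStrip hα₀ hf_mono.monotoneOn hf_pos hb_zero hb hb_top hXm
      (fun k => div_pos (hT k) h1θ) hblock (fun n => ?_) (fun n => ?_) (hF.trans hDV)
    · calc ∑ k ∈ Finset.range n, 1 / f (b k) * (c * b (k + 1) ^ δ / (1 - θ))
          = c * (∑ k ∈ Finset.range n, b (k + 1) ^ δ / f (b k)) / (1 - θ) := by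
            rw [Finset.mul_sum, Finset.sum_div]
            exact Finset.sum_congr rfl fun k _ => by ring
        _ ≤ C / (1 - θ) := by
            rw [hC]
            gcongr
            exact hC_sum.sum_le_tsum _ fun k _ => (hCterm k).le
    · calc ∑ k ∈ Finset.range n, 1 / f (b k) * (2 * ((c * b (k + 1) ^ δ) ^ (1 - a) *
            blockConst H₁ H₂ γ β ck b A k / ((1 - θ) * θ ^ a)))
          = 2 * (c ^ (1 - a) * ∑ k ∈ Finset.range n, b (k + 1) ^ (δ * (1 - a)) *
              blockConst H₁ H₂ γ β ck b A k / f (b k)) / ((1 - θ) * θ ^ a) := by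
            rw [Finset.mul_sum, Finset.mul_sum, Finset.sum_div]
            refine Finset.sum_congr rfl fun k _ => ?_
            rw [Real.mul_rpow hc.le (Real.rpow_nonneg (hb _) _), ← Real.rpow_mul (hb _)]
            ring
        _ ≤ 2 * S / ((1 - θ) * θ ^ a) := by
            rw [hS]
            gcongr
            exact hS_sum.sum_le_tsum _ fun k _ => div_nonneg
              (mul_nonneg (Real.rpow_nonneg (hb _) _) (hconst k)) (hfb k).le
  have hexp : ∀ l : ℝ, 0 < l →
      ∫⁻ ω, EReal.exp ((l : EReal) * weightedSup (halfStrip A) X f ω) ∂P ≤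
        ENNReal.ofReal (2 * Real.exp ((l * (C / (1 - θ))) ^ α / α +
          l * (2 * S / ((1 - θ) * θ ^ a)))) := fun l hl => by
    rw [lintegral_congr_ae (hW.mono fun ω hω => by rw [hω])]
    exact lintegral_exp_weightedSup_le hDc hDne (fun t ht => hf_pos _ (hDV ht).1) hbound hl
  refine ⟨fun l hl => (hexp l hl).trans_eq ?_, fun u hu => ?_⟩
  · rw [Real.mul_rpow hl.le (by positivity)]
    congr 3
    ring
  · refine (measure_lt_le_of_lintegral_exp_le hWm hα₁ hβ (div_pos hC₀ h1θ) hexp hu).trans_eq ?_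
    have hz : (u - 2 * S / ((1 - θ) * θ ^ a)) / (C / (1 - θ)) =
        (u * (1 - θ) - 2 * S * θ ^ (-a)) / C := by
      rw [Real.rpow_neg hθ.le]
      field_simp
    have hz₀ : 0 ≤ u * (1 - θ) - 2 * S * θ ^ (-a) := by
      rw [div_lt_iff₀ (by positivity), ← mul_assoc, ← div_lt_iff₀ hθa] at hu
      rw [Real.rpow_neg hθ.le, ← div_eq_mul_inv]
      linarith
    rw [hz, Real.div_rpow hz₀ hC₀.le]
    congr 3
    field_simp
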